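/- Let $G$ be a group acting on a nonempty set $X$, regarded as a discrete space. Assume that the action is f.s.o., i.e. for all $x,y\in X$ the orbit $G_x y$ of $y$ under the stabilizer $G_x=\{g\in G: gx=x\}$ is finite. Let $G'$ be the closure of $\{x\mapsto gx : g\in G\}$ in the space $\mathrm{Map}(X)$ of all maps $X\to X$ with the topology of pointwise convergence; under composition, $G'$ is a locally compact topological group of permutations of $X$ (the Schlichting group of the action). For an action of a group $H$ by homeomorphisms on a topological space $Z$, an $H$-invariant mean is a positive linear functional $m$ on the algebra $C_b(Z)$ of complex-valued bounded continuous functions on $Z$ with $m(1)=1$ and $m({}_hf)=m(f)$ for all $h\in H$, $f\in C_b(Z)$, where ${}_hf(z)=f(h^{-1}z)$. The action is called amenable if such a mean exists (for discrete $Z$, $C_b(Z)=\ell^\infty(Z)$), and a locally compact group is called amenable if its action on itself by left translations is amenable. Then the following conditions are equivalent: 1. the action of $G$ on $X$ is amenable; 2. there exists a $G$-orbit $Y\subseteq X$ such that the action of $G$ on $Y$ is amenable; 3. for every $G$-orbit $Y\subseteq X$, the action of $G$ on $Y$ is amenable; 4. the locally compact group $G'$ is amenable. -/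

import Mathlib

open Set Topology MulAction
open scoped BoundedContinuousFunction ComplexOrder

noncomputable section

/-- A mean on the algebra `C_b(Z)` of complex-valued bounded continuous functions:
a unital positive linear functional (`0 ≤ c` for complex `c` means `c` is real and nonnegative). -/
structure IsMean {Z : Type*} [TopologicalSpace Z] (m : (Z →ᵇ ℂ) →ₗ[ℂ] ℂ) : Prop where
  map_one : m 1 = 1
  nonneg : ∀ f : Z →ᵇ ℂ, (∀ z, 0 ≤ f z) → 0 ≤ m f

/-- The translate `z ↦ f (g⁻¹ • z)` of a bounded continuous function. -/
def bcfTranslate {G Z : Type*} [Group G] [TopologicalSpace Z] [MulAction G Z]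
    [ContinuousConstSMul G Z] (g : G) (f : Z →ᵇ ℂ) : Z →ᵇ ℂ :=
  f.compContinuous ⟨fun z => g⁻¹ • z, continuous_const_smul g⁻¹⟩

/-- The action of `G` on `Z` is (topologically) amenable in Greenleaf's sense: there is a
`G`-invariant mean on `C_b(Z)`. When `Z` is discrete, `C_b(Z)` is `ℓ^∞(Z)`. -/
def IsAmenableAction (G Z : Type*) [Group G] [TopologicalSpace Z] [MulAction G Z]
    [ContinuousConstSMul G Z] : Prop :=
  ∃ m : (Z →ᵇ ℂ) →ₗ[ℂ] ℂ, IsMean m ∧ ∀ (g : G) (f : Z →ᵇ ℂ), m (bcfTranslate g f) = m f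

/-- Every action on a discrete space is by homeomorphisms. -/
instance discreteContinuousConstSMul (G Z : Type*) [Group G] [TopologicalSpace Z]
    [DiscreteTopology Z] [MulAction G Z] : ContinuousConstSMul G Z :=
  ⟨fun _ => continuous_of_discreteTopology⟩

/-- A locally compact group is amenable if its action on itself by left translations is. -/
def IsAmenableGroup (𝔊 : Type*) [Group 𝔊] [TopologicalSpace 𝔊] [IsTopologicalGroup 𝔊]
    [LocallyCompactSpace 𝔊] : Prop :=
  IsAmenableAction 𝔊 𝔊

/-- The action of `G` on `X` is f.s.o. (finite stabilizers orbits): every stabilizer has only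
finite orbits. -/
class IsFSO (G X : Type*) [Group G] [MulAction G X] : Prop where
  finite_orbit : ∀ x y : X, (orbit (stabilizer G x) y).Finite

/-- The Schlichting group: the closure of the image of `G` in the space `X → X` of all maps
(the topology of `X → X` is that of pointwise convergence, `X` being discrete). -/
def SchlichtingGroup (G X : Type*) [Group G] [MulAction G X] [TopologicalSpace X] : Type _ :=
  {φ : X → X // φ ∈ closure (range fun (g : G) (x : X) => g • x)}

namespace SchlichtingGroup

variable {G X : Type*} [Group G] [MulAction G X] [TopologicalSpace X]

/-- The topology of pointwise convergence, induced from `X → X`. -/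
instance : TopologicalSpace (SchlichtingGroup G X) := instTopologicalSpaceSubtype

variable [DiscreteTopology X]

theorem mem_closure_iff' {φ : X → X} :
    φ ∈ closure (range fun (g : G) (x : X) => g • x) ↔
      ∀ F : Set X, F.Finite → ∃ g : G, ∀ x ∈ F, g • x = φ x := by
  rw [mem_closure_iff]
  constructor
  · intro h F hF
    obtain ⟨_, hψ, g, rfl⟩ := h (F.pi fun x => {φ x})
      (isOpen_set_pi hF fun _ _ => isOpen_discrete _) (fun x _ => rfl)
    exact ⟨g, fun x hx => hψ x hx⟩
  · intro h U hU hφ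
    obtain ⟨I, u, hu, hsub⟩ := isOpen_pi_iff.1 hU φ hφ
    obtain ⟨g, hg⟩ := h I I.finite_toSet
    exact ⟨_, hsub fun x hx => by simpa [hg x hx] using (hu x hx).2, g, rfl⟩

theorem exists_eqOn (φ : SchlichtingGroup G X) {F : Set X} (hF : F.Finite) :
    ∃ g : G, ∀ x ∈ F, g • x = φ.1 x :=
  mem_closure_iff'.1 φ.2 F hF

theorem injective (φ : SchlichtingGroup G X) : Function.Injective φ.1 := by
  intro x y h
  obtain ⟨g, hg⟩ := φ.exists_eqOn (F := {x, y}) (by simp)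
  have hx := hg x (by simp)
  have hy := hg y (by simp)
  exact smul_left_cancel g (by rw [hx, hy, h])

variable [IsFSO G X]

theorem surjective (φ : SchlichtingGroup G X) : Function.Surjective φ.1 := by
  intro y
  obtain ⟨g₀, hg₀⟩ := φ.exists_eqOn (F := {y}) (by simp)
  have h₀ : g₀ • y = φ.1 y := hg₀ y rfl
  -- `g₀⁻¹ φ` fixes `y`, hence permutes the finite orbit of `g₀⁻¹ y` under the stabilizer of `y`
  have hfin := IsFSO.finite_orbit (G := G) y (g₀⁻¹ • y)
  have hmaps : MapsTo (fun z => g₀⁻¹ • φ.1 z) (orbit (stabilizer G y) (g₀⁻¹ • y))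
      (orbit (stabilizer G y) (g₀⁻¹ • y)) := by
    intro z hz
    obtain ⟨g, hg⟩ := φ.exists_eqOn (F := {y, z}) (by simp)
    have hy := hg y (by simp)
    have hz' := hg z (by simp)
    have hmem : g₀⁻¹ * g ∈ stabilizer G y := by
      rw [mem_stabilizer_iff, mul_smul, hy, ← h₀, inv_smul_smul]
    have : g₀⁻¹ • φ.1 z = (⟨g₀⁻¹ * g, hmem⟩ : stabilizer G y) • z := by
      rw [← hz']; exact (mul_smul _ _ _).symm
    change g₀⁻¹ • φ.1 z ∈ _
    rw [this]
    exact mem_orbit_of_mem_orbit _ hz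
  have hinj : Function.Injective fun z => g₀⁻¹ • φ.1 z :=
    (MulAction.injective g₀⁻¹).comp φ.injective
  obtain ⟨z, -, hz⟩ := ((hfin.injOn_iff_bijOn_of_mapsTo hmaps).1 hinj.injOn).surjOn
    (mem_orbit_self (M := stabilizer G y) (g₀⁻¹ • y))
  exact ⟨z, MulAction.injective g₀⁻¹ hz⟩

/-- The elements of the Schlichting group are permutations of `X`. -/
def toPerm (φ : SchlichtingGroup G X) : Equiv.Perm X :=
  Equiv.ofBijective φ.1 ⟨φ.injective, φ.surjective⟩

/-- The group structure: composition of maps. -/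
instance : Group (SchlichtingGroup G X) where
  one := ⟨id, mem_closure_iff'.2 fun _ _ => ⟨1, fun x _ => one_smul G x⟩⟩
  mul φ ψ := ⟨φ.1 ∘ ψ.1, mem_closure_iff'.2 fun F hF => by
    obtain ⟨h, hh⟩ := ψ.exists_eqOn hF
    obtain ⟨g, hg⟩ := φ.exists_eqOn (hF.image ψ.1)
    refine ⟨g * h, fun x hx => ?_⟩
    rw [mul_smul, hh x hx, hg _ (mem_image_of_mem _ hx)]
    rfl⟩
  inv φ := ⟨φ.toPerm.symm, mem_closure_iff'.2 fun F hF => by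
    obtain ⟨g, hg⟩ := φ.exists_eqOn (hF.image φ.toPerm.symm)
    refine ⟨g⁻¹, fun x hx => ?_⟩
    rw [inv_smul_eq_iff, hg _ (mem_image_of_mem _ hx)]
    exact (φ.toPerm.apply_symm_apply x).symm⟩
  mul_assoc _ _ _ := rfl
  one_mul _ := rfl
  mul_one _ := rfl
  inv_mul_cancel φ := Subtype.ext (funext fun x => φ.toPerm.symm_apply_apply x)

theorem isOpen_setOf_apply_eq (x y : X) : IsOpen {φ : SchlichtingGroup G X | φ.1 x = y} :=
  have h : Continuous fun φ : SchlichtingGroup G X => φ.1 x :=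
    (continuous_apply (A := fun _ : X => X) x).comp continuous_subtype_val
  (isOpen_discrete {y}).preimage h

instance : IsTopologicalGroup (SchlichtingGroup G X) where
  continuous_mul := by
    refine Continuous.subtype_mk (continuous_pi fun x => ?_) _
    refine (IsLocallyConstant.iff_exists_open _).2 (fun p => ?_) |>.continuous
    refine ⟨{φ : SchlichtingGroup G X | φ.1 (p.2.1 x) = p.1.1 (p.2.1 x)} ×ˢ
        {ψ : SchlichtingGroup G X | ψ.1 x = p.2.1 x},
      (isOpen_setOf_apply_eq (p.2.1 x) (p.1.1 (p.2.1 x))).prod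
        (isOpen_setOf_apply_eq x (p.2.1 x)), ⟨rfl, rfl⟩, ?_⟩
    rintro ⟨φ, ψ⟩ ⟨h₁, h₂⟩
    change φ.1 (ψ.1 x) = p.1.1 (p.2.1 x)
    rw [show ψ.1 x = p.2.1 x from h₂]
    exact h₁
  continuous_inv := by
    refine Continuous.subtype_mk (continuous_pi fun x => ?_) _
    refine (IsLocallyConstant.iff_exists_open _).2 (fun p => ?_) |>.continuous
    refine ⟨{φ | φ.1 (p.toPerm.symm x) = x}, isOpen_setOf_apply_eq _ _,
      p.toPerm.apply_symm_apply x, fun φ hφ => ?_⟩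
    exact (Equiv.symm_apply_eq φ.toPerm).2 (Eq.symm hφ)

instance : T2Space (SchlichtingGroup G X) := inferInstanceAs (T2Space (Subtype _))

theorem isCompact_setOf_apply_eq (x y : X) :
    IsCompact {φ : SchlichtingGroup G X | φ.1 x = y} := by
  rcases eq_empty_or_nonempty {φ : SchlichtingGroup G X | φ.1 x = y} with h | ⟨φ₀, h₀⟩
  · rw [h]; exact isCompact_empty
  obtain ⟨g₀, hg₀⟩ := φ₀.exists_eqOn (F := {x}) (by simp)
  have hg₀x : g₀ • x = y := (hg₀ x rfl).trans h₀
  have hK : IsCompact (univ.pi fun z : X => (g₀ • ·) '' orbit (stabilizer G x) z) :=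
    isCompact_univ_pi fun z => ((IsFSO.finite_orbit x z).image _).isCompact
  have hcl : IsClosed (closure (range fun (g : G) (z : X) => g • z) ∩ {f | f x = y}) :=
    isClosed_closure.inter
      ((isClosed_discrete {y}).preimage (continuous_apply (A := fun _ : X => X) x))
  have hind : IsInducing fun φ : SchlichtingGroup G X => φ.1 := ⟨rfl⟩
  have hsub : (fun φ : SchlichtingGroup G X => φ.1) '' {φ : SchlichtingGroup G X | φ.1 x = y} =
      closure (range fun (g : G) (z : X) => g • z) ∩ {f | f x = y} := by
    ext f
    constructor
    · rintro ⟨φ, hφ, rfl⟩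
      exact ⟨φ.2, hφ⟩
    · rintro ⟨hf, hfx⟩
      exact ⟨⟨f, hf⟩, hfx, rfl⟩
  refine hind.isCompact_iff.2 ?_
  rw [hsub]
  refine hK.of_isClosed_subset hcl ?_
  rintro f ⟨hf, hfx⟩ z -
  obtain ⟨g, hg⟩ := mem_closure_iff'.1 hf {x, z} (by simp)
  have hx : g • x = y := (hg x (by simp)).trans hfx
  have hz : g • z = f z := hg z (by simp)
  have hmem : g₀⁻¹ * g ∈ stabilizer G x := by
    rw [mem_stabilizer_iff, mul_smul, hx, ← hg₀x, inv_smul_smul]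
  refine ⟨_, ⟨⟨g₀⁻¹ * g, hmem⟩, rfl⟩, ?_⟩
  change g₀ • ((g₀⁻¹ * g) • z) = f z
  rw [smul_smul, mul_inv_cancel_left, hz]

instance : LocallyCompactSpace (SchlichtingGroup G X) := by
  have : WeaklyLocallyCompactSpace (SchlichtingGroup G X) := ⟨fun φ => by
    rcases isEmpty_or_nonempty X with hX | ⟨⟨x⟩⟩
    · have : Subsingleton (SchlichtingGroup G X) :=
        ⟨fun a b => Subtype.ext (funext fun x => hX.elim x)⟩
      exact ⟨univ, subsingleton_univ.isCompact, Filter.univ_mem⟩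
    · exact ⟨_, isCompact_setOf_apply_eq x (φ.1 x),
        (isOpen_setOf_apply_eq x (φ.1 x)).mem_nhds rfl⟩⟩
  infer_instance

end SchlichtingGroup

end

open MeasureTheory

noncomputable section

/-! Invariant means push forward along equivariant continuous maps. The inclusion of an orbit in `X`
and the orbit maps of the Schlichting group `S` thus give every implication except the passage from
a mean `m` on `X` to one on `S`. That passage has two steps. A `G`-invariant `m` need not be
`S`-invariant, so it is replaced by `F ↦ m (1_K * F)` with `K` a compact open point stabilizer. For
`h` in `S`, `K` and `K h` are finite unions of left cosets of one open subgroup `L`. By density each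
coset is `g L` with `g` from `G`, so all have the same averaged mean as `L`. Hence `m (1_K * hF)`
and `m (1_K * F)` are proportional, and `F = 1` shows that they agree
(`mean_convIndicator_bcfTranslate`). Then `fiberAverage`, a unital positive `S`-equivariant map from
`C_b(S)` to `ℓ^∞(X)`, pulls the new mean back to `S`. -/

@[simp]
theorem bcfTranslate_apply {G Z : Type*} [Group G] [TopologicalSpace Z] [MulAction G Z]
    [ContinuousConstSMul G Z] (g : G) (f : Z →ᵇ ℂ) (z : Z) :
    bcfTranslate g f z = f (g⁻¹ • z) := rfl

/-- Amenability passes to the target of a continuous map that is equivariant along some map of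
the acting groups. -/
theorem IsAmenableAction.map {H Z G W : Type*} [Group H] [TopologicalSpace Z] [MulAction H Z]
    [ContinuousConstSMul H Z] [Group G] [TopologicalSpace W] [MulAction G W]
    [ContinuousConstSMul G W] (h : IsAmenableAction H Z) (ρ : G → H) (π : C(Z, W))
    (hπ : ∀ g z, π ((ρ g)⁻¹ • z) = g⁻¹ • π z) : IsAmenableAction G W := by
  obtain ⟨m, hm, hinv⟩ := h
  refine ⟨⟨⟨fun f => m (f.compContinuous π), fun f f' => ?_⟩, fun c f => ?_⟩,
    ⟨?_, fun f hf => hm.nonneg _ fun z => hf _⟩, fun g f => ?_⟩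
  · rw [← map_add]; rfl
  · exact map_smul m c (f.compContinuous π)
  · exact hm.map_one
  · refine Eq.trans (congrArg m ?_) (hinv (ρ g) (f.compContinuous π))
    ext z
    exact congrArg f (hπ g z).symm

theorem BoundedContinuousFunction.integrableOn {S : Type*} [TopologicalSpace S]
    [MeasurableSpace S] [OpensMeasurableSpace S] {μ : Measure S} {U : Set S} (hU : μ U ≠ ⊤)
    (f : S →ᵇ ℂ) : IntegrableOn f U μ := by
  have : IsFiniteMeasure (μ.restrict U) := ⟨by simpa using hU.lt_top⟩
  exact f.integrable _

theorem isOpen_setOf_smul_eq {S X : Type*} [Group S] [TopologicalSpace S] [MulAction S X]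
    [TopologicalSpace X] [DiscreteTopology X] [ContinuousSMul S X] (x y : X) :
    IsOpen {s : S | s • y = x} :=
  (isOpen_discrete {x}).preimage (by fun_prop : Continuous fun s : S => s • y)

/-! ### Convolution with indicator functions, and averages over fibers of orbit maps -/

section Averaging

variable {S X : Type*} [Group S] [TopologicalSpace S] [MeasurableSpace S] [BorelSpace S]
  [MulAction S X] [TopologicalSpace X] [DiscreteTopology X]

/-- The bounded continuous function `s ↦ F (s⁻¹ • x)` on the acting group. -/
def orbitFunction [IsTopologicalGroup S] [ContinuousSMul S X] (F : X →ᵇ ℂ) (x : X) : S →ᵇ ℂ :=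
  F.compContinuous ⟨fun s => s⁻¹ • x, by fun_prop⟩

/-- The operator `F ↦ (x ↦ ∫ s in U, F (s⁻¹ • x) ∂μ)` on bounded functions, i.e. convolution
with the indicator function of `U`. -/
def convIndicator [IsTopologicalGroup S] [ContinuousSMul S X] (μ : Measure S) (U : Set S)
    (hU : μ U ≠ ⊤) : (X →ᵇ ℂ) →ₗ[ℂ] (X →ᵇ ℂ) where
  toFun F := .ofNormedAddCommGroupDiscrete (fun x => ∫ s in U, orbitFunction F x s ∂μ)
    (‖F‖ * μ.real U)
    fun x => norm_setIntegral_le_of_norm_le_const hU.lt_top fun s _ => F.norm_coe_le_norm _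
  map_add' F F' := by
    ext x
    exact integral_add ((orbitFunction F x).integrableOn hU) ((orbitFunction F' x).integrableOn hU)
  map_smul' c F := by
    ext x
    exact integral_const_mul c _

section

variable [IsTopologicalGroup S] [ContinuousSMul S X] {μ : Measure S}

theorem convIndicator_apply {U : Set S} (hU : μ U ≠ ⊤) (F : X →ᵇ ℂ) (x : X) :
    convIndicator μ U hU F x = ∫ s in U, F (s⁻¹ • x) ∂μ := rfl

theorem convIndicator_one {U : Set S} (hU : μ U ≠ ⊤) :
    convIndicator μ U hU (1 : X →ᵇ ℂ) = (μ.real U : ℂ) • 1 := by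
  ext x
  simp [convIndicator_apply]

theorem convIndicator_nonneg {U : Set S} (hU : μ U ≠ ⊤) {F : X →ᵇ ℂ} (hF : ∀ x, 0 ≤ F x) (x : X) :
    0 ≤ convIndicator μ U hU F x :=
  integral_nonneg fun _ => hF _

/-- The substitution `s ↦ g * s` preserves `μ` and turns a left translation of the set into a
translation of the resulting function on `X`, which an invariant mean ignores. -/
theorem convIndicator_preimage_mul_left [μ.IsMulLeftInvariant] {U : Set S} (hU : μ U ≠ ⊤) (g : S)
    (hV : μ ((g * ·) ⁻¹' U) ≠ ⊤) (F : X →ᵇ ℂ) :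
    convIndicator μ U hU F = bcfTranslate g (convIndicator μ ((g * ·) ⁻¹' U) hV F) := by
  ext x
  rw [bcfTranslate_apply, convIndicator_apply, convIndicator_apply,
    ← (measurePreserving_mul_left μ g).setIntegral_preimage_emb
      (MeasurableEquiv.mulLeft g).measurableEmbedding]
  simp only [mul_inv_rev, mul_smul]

/-- By uniqueness of Haar measure, right translation by `h` rescales `μ`. Only the independence of
`c` from `U` and `F` matters; its modular value is never computed. -/
theorem exists_convIndicator_bcfTranslate [LocallyCompactSpace S] [μ.IsHaarMeasure] [μ.Regular]
    (h : S) : ∃ c : ℂ, ∀ (U : Set S) (hU : μ U ≠ ⊤) (hV : μ ((· * h) ⁻¹' U) ≠ ⊤) (F : X →ᵇ ℂ),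
      convIndicator μ ((· * h) ⁻¹' U) hV (bcfTranslate h F) = c • convIndicator μ U hU F := by
  have : (μ.map (· * h)).Regular := Measure.Regular.map (Homeomorph.mulRight h)
  have hμ := Measure.isMulLeftInvariant_eq_smul_of_regular (μ.map (· * h)) μ
  refine ⟨((Measure.haarScalarFactor (μ.map (· * h)) μ : ℝ) : ℂ), fun U hU hV F => ?_⟩
  ext x
  have h1 := (MeasurableEquiv.mulRight h).measurableEmbedding.setIntegral_map (μ := μ)
    (fun s => F (s⁻¹ • x)) U
  simp only [MeasurableEquiv.coe_mulRight] at h1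
  rw [hμ, Measure.restrict_smul, integral_smul_nnreal_measure] at h1
  rw [BoundedContinuousFunction.coe_smul, convIndicator_apply]
  simp only [convIndicator_apply, bcfTranslate_apply, ← mul_smul, ← mul_inv_rev]
  rw [← h1]
  rfl

/-- For a mean that is invariant under a dense group, averages over a compact set which is
right invariant under a compact open subgroup `L` are proportional to those over `L`. -/
theorem exists_mean_convIndicator {G : Type*} [Group G] [MulAction G X] [μ.IsMulLeftInvariant]
    [IsFiniteMeasureOnCompacts μ]
    (ι : G → S) (hι : DenseRange ι) (hsmul : ∀ g (x : X), (ι g)⁻¹ • x = g⁻¹ • x)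
    (m : (X →ᵇ ℂ) →ₗ[ℂ] ℂ) (hm : ∀ (g : G) (f : X →ᵇ ℂ), m (bcfTranslate g f) = m f)
    (L : Subgroup S) (hLo : IsOpen (L : Set S)) (hL : μ (L : Set S) ≠ ⊤)
    {U : Set S} (hUc : IsCompact U) (hUL : ∀ u ∈ U, ∀ l ∈ L, u * l ∈ U) :
    ∃ n : ℂ, ∀ F : X →ᵇ ℂ, m (convIndicator μ U hUc.measure_lt_top.ne F) =
      n * m (convIndicator μ (L : Set S) hL F) := by
  have : DiscreteTopology (S ⧸ L) := QuotientGroup.discreteTopology hLo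
  let V : S ⧸ L → Set S := fun c => {s | (s : S ⧸ L) = c}
  have hVo : ∀ c, IsOpen (V c) := fun c =>
    (isOpen_discrete {c}).preimage QuotientGroup.continuous_mk
  have hfin : ((fun s : S => (s : S ⧸ L)) '' U).Finite :=
    (hUc.image QuotientGroup.continuous_mk).finite_of_discrete
  have hUV : U = ⋃ c ∈ hfin.toFinset, V c := by
    ext s
    simp only [Finite.mem_toFinset, mem_iUnion, V, mem_ofPred_eq, exists_prop, exists_eq_right',
      mem_image]
    refine ⟨fun hs => ⟨s, hs, rfl⟩, ?_⟩
    rintro ⟨u, hu, hus⟩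
    simpa using hUL u hu _ (QuotientGroup.eq.1 hus)
  -- The coset `c` is open and nonempty, so it contains some `ι g` and equals `ι g * L`.
  have hpre : ∀ c, ∃ g : G, (ι g * ·) ⁻¹' V c = (L : Set S) := by
    intro c
    obtain ⟨s, hs⟩ := QuotientGroup.mk_surjective c
    obtain ⟨g, hg⟩ := hι.exists_mem_open (hVo c) ⟨s, hs⟩
    refine ⟨g, ?_⟩
    ext l
    have hg' : (ι g : S ⧸ L) = c := hg
    simp only [V, mem_preimage, mem_ofPred_eq, ← hg', SetLike.mem_coe]
    rw [eq_comm, QuotientGroup.eq, inv_mul_cancel_left]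
  have hVfin : ∀ c, μ (V c) ≠ ⊤ := by
    intro c
    obtain ⟨g, hg⟩ := hpre c
    rwa [← measure_preimage_mul μ (ι g), hg]
  have hmV : ∀ c (F : X →ᵇ ℂ),
      m (convIndicator μ (V c) (hVfin c) F) = m (convIndicator μ (L : Set S) hL F) := by
    intro c F
    obtain ⟨g, hg⟩ := hpre c
    rw [convIndicator_preimage_mul_left _ (ι g) (by rwa [hg]),
      ← hm g (convIndicator μ (L : Set S) hL F)]
    congr 1
    ext x
    simp only [bcfTranslate_apply, hsmul, hg]
  -- The factor is the number of left cosets of `L` that make up `U`.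
  refine ⟨hfin.toFinset.card, fun F => ?_⟩
  have hsum : convIndicator μ U hUc.measure_lt_top.ne F =
      ∑ c ∈ hfin.toFinset, convIndicator μ (V c) (hVfin c) F := by
    ext x
    rw [BoundedContinuousFunction.coe_sum, Finset.sum_apply, convIndicator_apply]
    conv_lhs => rw [hUV]
    refine integral_biUnion_finset _ (fun c _ => (hVo c).measurableSet) ?_
      fun c _ => (orbitFunction F x).integrableOn (hVfin c)
    intro c _ d _ hcd
    exact disjoint_left.2 fun s hc hd => hcd (Eq.trans (Eq.symm hc) hd)
  simp [hsum, map_sum, hmV]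

/-- For a mean that is invariant under a dense group, averaging over a compact open subgroup
yields invariance under the whole group. -/
theorem mean_convIndicator_bcfTranslate {G : Type*} [Group G] [MulAction G X]
    [LocallyCompactSpace S] [μ.IsHaarMeasure] [μ.Regular]
    (ι : G → S) (hι : DenseRange ι) (hsmul : ∀ g (x : X), (ι g)⁻¹ • x = g⁻¹ • x)
    {m : (X →ᵇ ℂ) →ₗ[ℂ] ℂ} (hm1 : m 1 = 1)
    (hm : ∀ (g : G) (f : X →ᵇ ℂ), m (bcfTranslate g f) = m f)
    (K : Subgroup S) (hKo : IsOpen (K : Set S)) (hKc : IsCompact (K : Set S)) (h : S)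
    (F : X →ᵇ ℂ) :
    m (convIndicator μ (K : Set S) hKc.measure_lt_top.ne (bcfTranslate h F)) =
      m (convIndicator μ (K : Set S) hKc.measure_lt_top.ne F) := by
  -- `L = K ∩ h⁻¹ K h` makes both `K` and `K h` right `L`-invariant.
  let L : Subgroup S := K ⊓ K.comap (MulAut.conj h).toMonoidHom
  have hLo : IsOpen (L : Set S) :=
    hKo.inter (hKo.preimage (by fun_prop : Continuous fun s : S => h * s * h⁻¹))
  have hL : μ (L : Set S) ≠ ⊤ :=
    ((measure_mono inter_subset_left).trans_lt hKc.measure_lt_top).ne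
  have hLpos : (μ.real (L : Set S) : ℂ) ≠ 0 := by
    have := hLo.measure_pos μ ⟨1, L.one_mem⟩
    exact_mod_cast (ENNReal.toReal_pos this.ne' hL).ne'
  have hUc : IsCompact ((· * h⁻¹) ⁻¹' (K : Set S)) :=
    (Homeomorph.mulRight h⁻¹).isCompact_preimage.2 hKc
  have hpre : (· * h) ⁻¹' ((· * h⁻¹) ⁻¹' (K : Set S)) = K := by
    ext s; simp
  obtain ⟨n₁, hn₁⟩ := exists_mean_convIndicator ι hι hsmul m hm L hLo hL hKc
    fun u hu l hl => K.mul_mem hu hl.1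
  obtain ⟨n₂, hn₂⟩ := exists_mean_convIndicator ι hι hsmul m hm L hLo hL hUc
    fun u hu l hl => by
      have : u * l * h⁻¹ = (u * h⁻¹) * (h * l * h⁻¹) := by group
      simp only [mem_preimage, this]
      exact K.mul_mem hu hl.2
  obtain ⟨c, hc⟩ := exists_convIndicator_bcfTranslate (X := X) (μ := μ) h
  have hc' : ∀ F : X →ᵇ ℂ,
      convIndicator μ (K : Set S) hKc.measure_lt_top.ne (bcfTranslate h F) =
        c • convIndicator μ ((· * h⁻¹) ⁻¹' (K : Set S)) hUc.measure_lt_top.ne F := by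
    intro F
    rw [← hc _ hUc.measure_lt_top.ne (by rw [hpre]; exact hKc.measure_lt_top.ne)]
    simp only [hpre]
  have key : ∀ F : X →ᵇ ℂ,
      m (convIndicator μ (K : Set S) hKc.measure_lt_top.ne (bcfTranslate h F)) =
        (c * n₂) * m (convIndicator μ (L : Set S) hL F) := by
    intro F
    rw [hc', map_smul, hn₂, smul_eq_mul, mul_assoc]
  -- Testing on the constant function gives `n₁ = c * n₂`, as `L` has nonzero measure.
  have h1 := key 1
  rw [show bcfTranslate h (1 : X →ᵇ ℂ) = 1 from rfl, hn₁, convIndicator_one, map_smul, hm1,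
    smul_eq_mul, mul_one] at h1
  rw [key, hn₁, mul_right_cancel₀ hLpos h1]

end

/-- Given a section `r` of the orbit map of `X`, average a bounded continuous function on the
group over the sets `{s | s • r x = x}`. -/
def fiberAverage (μ : Measure S) (r : X → X) (hr : ∀ x, μ {s : S | s • r x = x} ≠ ⊤) :
    (S →ᵇ ℂ) →ₗ[ℂ] (X →ᵇ ℂ) where
  toFun f := .ofNormedAddCommGroupDiscrete
    (fun x => (μ.real {s : S | s • r x = x} : ℂ)⁻¹ * ∫ s in {s | s • r x = x}, f s ∂μ)
    ‖f‖ fun x => by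
      have h := norm_setIntegral_le_of_norm_le_const (μ := μ) (hr x).lt_top
        fun s _ => f.norm_coe_le_norm s
      rw [norm_mul, norm_inv, Complex.norm_real, Real.norm_of_nonneg measureReal_nonneg]
      refine (mul_le_mul_of_nonneg_left h (by positivity)).trans ?_
      rw [mul_left_comm]
      exact mul_le_of_le_one_right (norm_nonneg _) inv_mul_le_one
  map_add' f f' := by
    ext x
    refine Eq.trans (congrArg (_ * ·) (integral_add (f.integrableOn (hr x)) (f'.integrableOn (hr x)))) ?_
    exact mul_add _ _ _
  map_smul' c f := by
    ext x
    refine Eq.trans (congrArg (_ * ·) (integral_const_mul c _)) ?_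
    exact mul_left_comm _ _ _

theorem fiberAverage_apply (μ : Measure S) (r : X → X) (hr : ∀ x, μ {s : S | s • r x = x} ≠ ⊤)
    (f : S →ᵇ ℂ) (x : X) : fiberAverage μ r hr f x =
      (μ.real {s : S | s • r x = x} : ℂ)⁻¹ * ∫ s in {s | s • r x = x}, f s ∂μ := rfl

theorem fiberAverage_nonneg (μ : Measure S) (r : X → X) (hr : ∀ x, μ {s : S | s • r x = x} ≠ ⊤)
    {f : S →ᵇ ℂ} (hf : ∀ s, 0 ≤ f s) (x : X) : 0 ≤ fiberAverage μ r hr f x := by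
  have h : (0 : ℂ) ≤ (μ.real {s : S | s • r x = x} : ℂ)⁻¹ := by
    rw [← Complex.ofReal_inv]
    exact Complex.zero_le_real.2 (inv_nonneg.2 measureReal_nonneg)
  exact mul_nonneg h (integral_nonneg hf)

theorem fiberAverage_one [ContinuousSMul S X] (μ : Measure S) [μ.IsOpenPosMeasure] (r : X → X)
    (hr : ∀ x, μ {s : S | s • r x = x} ≠ ⊤) (hrx : ∀ x, ∃ s : S, s • r x = x) :
    fiberAverage μ r hr 1 = 1 := by
  ext x
  have h : (μ.real {s : S | s • r x = x} : ℂ) ≠ 0 := by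
    have := (isOpen_setOf_smul_eq (S := S) x (r x)).measure_pos μ (hrx x)
    exact_mod_cast (ENNReal.toReal_pos this.ne' (hr x)).ne'
  simp [fiberAverage_apply, h]

/-- As `r` is constant on orbits, left translation by `h` carries the fiber over `h⁻¹ • x` onto the
fiber over `x`, and `μ` is left invariant. -/
theorem fiberAverage_bcfTranslate [IsTopologicalGroup S] (μ : Measure S) [μ.IsMulLeftInvariant]
    (r : X → X)
    (hr : ∀ x, μ {s : S | s • r x = x} ≠ ⊤) (hrs : ∀ (s : S) x, r (s • x) = r x) (h : S)
    (f : S →ᵇ ℂ) :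
    fiberAverage μ r hr (bcfTranslate h f) = bcfTranslate h (fiberAverage μ r hr f) := by
  ext x
  have hpre : {s : S | s • r x = x} =
      (h⁻¹ * ·) ⁻¹' {s : S | s • r (h⁻¹ • x) = h⁻¹ • x} := by
    ext s
    simp [hrs, mul_smul]
  have h1 : μ.real {s : S | s • r x = x} = μ.real {s : S | s • r (h⁻¹ • x) = h⁻¹ • x} := by
    rw [hpre, measureReal_def, measure_preimage_mul, measureReal_def]
  rw [bcfTranslate_apply, fiberAverage_apply, fiberAverage_apply, h1]
  congr 1
  rw [hpre]
  exact (measurePreserving_mul_left μ h⁻¹).setIntegral_preimage_emb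
    (MeasurableEquiv.mulLeft h⁻¹).measurableEmbedding f _

end Averaging

/-- If a dense group acts amenably on a discrete space on which the ambient topological group acts
continuously with compact stabilizers, then the ambient group is amenable. -/
theorem IsAmenableAction.of_denseRange {G S X : Type*} [Group G] [Group S] [TopologicalSpace S]
    [IsTopologicalGroup S] [LocallyCompactSpace S] [TopologicalSpace X] [DiscreteTopology X]
    [Nonempty X] [MulAction G X] [MulAction S X] [ContinuousSMul S X]
    (hX : IsAmenableAction G X) (ι : G → S) (hι : DenseRange ι)
    (hsmul : ∀ g (x : X), (ι g)⁻¹ • x = g⁻¹ • x)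
    (hc : ∀ x y : X, IsCompact {s : S | s • y = x}) : IsAmenableAction S S := by
  obtain ⟨m, hm, hinv⟩ := hX
  obtain ⟨x₀⟩ := ‹Nonempty X›
  borelize S
  let μ : Measure S := Measure.haar
  -- One representative per `S`-orbit: the action need not be transitive.
  let r : X → X := fun x => Quotient.out (Quotient.mk (orbitRel S X) x)
  have hrs : ∀ (s : S) x, r (s • x) = r x := fun s x =>
    congrArg Quotient.out (Quotient.sound (s := orbitRel S X) (mem_orbit x s))
  have hrx : ∀ x, ∃ s : S, s • r x = x := fun x =>
    mem_orbit_iff.1 ((orbitRel S X).symm (Quotient.mk_out (s := orbitRel S X) x))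
  have hr : ∀ x, μ {s : S | s • r x = x} ≠ ⊤ := fun x => (hc x (r x)).measure_lt_top.ne
  let K := stabilizer S x₀
  have hKo : IsOpen (K : Set S) := isOpen_setOf_smul_eq x₀ x₀
  have hKc : IsCompact (K : Set S) := hc x₀ x₀
  have hK := hKc.measure_lt_top (μ := μ) |>.ne
  have hKpos : 0 < μ.real (K : Set S) :=
    ENNReal.toReal_pos (hKo.measure_pos μ ⟨1, K.one_mem⟩).ne' hK
  refine ⟨(μ.real (K : Set S) : ℂ)⁻¹ • m ∘ₗ convIndicator μ (K : Set S) hK ∘ₗ fiberAverage μ r hr,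
    ⟨?_, fun f hf => ?_⟩, fun h f => ?_⟩
  · simp only [LinearMap.smul_apply, LinearMap.comp_apply, fiberAverage_one μ r hr hrx,
      convIndicator_one, map_smul, hm.map_one, smul_eq_mul, mul_one]
    exact inv_mul_cancel₀ (by exact_mod_cast hKpos.ne')
  · refine mul_nonneg ?_
      (hm.nonneg _ (convIndicator_nonneg hK (fiberAverage_nonneg μ r hr hf)))
    rw [← Complex.ofReal_inv]
    exact Complex.zero_le_real.2 (inv_nonneg.2 hKpos.le)
  · simp only [LinearMap.smul_apply, LinearMap.comp_apply, fiberAverage_bcfTranslate μ r hr hrs]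
    rw [mean_convIndicator_bcfTranslate ι hι hsmul hm.map_one hinv K hKo hKc h]

/-! ### Evaluation action of the Schlichting group and density of the image of `G` -/

namespace SchlichtingGroup

variable {G X : Type*} [Group G] [MulAction G X] [TopologicalSpace X] [DiscreteTopology X]
  [IsFSO G X]

/-- The Schlichting group acts on `X` by evaluation. -/
instance : MulAction (SchlichtingGroup G X) X where
  smul φ x := φ.1 x
  one_smul _ := rfl
  mul_smul _ _ _ := rfl

instance : ContinuousSMul (SchlichtingGroup G X) X where
  continuous_smul := by
    refine (IsLocallyConstant.iff_exists_open _).2 (fun p => ?_) |>.continuous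
    refine ⟨{φ : SchlichtingGroup G X | φ.1 p.2 = p.1.1 p.2} ×ˢ {p.2},
      (isOpen_setOf_apply_eq _ _).prod (isOpen_discrete _), ⟨rfl, rfl⟩, ?_⟩
    rintro ⟨φ, x⟩ ⟨hφ, rfl⟩
    exact hφ

variable (G X) in
/-- The map from `G` to its Schlichting group. -/
def of (g : G) : SchlichtingGroup G X :=
  ⟨fun x => g • x, subset_closure ⟨g, rfl⟩⟩

theorem of_inv_smul (g : G) (x : X) : (of G X g)⁻¹ • x = g⁻¹ • x := by
  rw [inv_smul_eq_iff]
  exact (smul_inv_smul g x).symm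

variable (G X) in
theorem denseRange_of : DenseRange (of G X) := by
  intro φ
  have h : IsInducing fun φ : SchlichtingGroup G X => φ.1 := ⟨rfl⟩
  rw [h.closure_eq_preimage_closure_image, ← range_comp]
  exact φ.2

theorem smul_mem_orbit (φ : SchlichtingGroup G X) (x : X) : φ • x ∈ orbit G x := by
  obtain ⟨g, hg⟩ := φ.exists_eqOn (F := {x}) (by simp)
  exact ⟨g, hg x rfl⟩

end SchlichtingGroup

end

theorem proposition4p1 (G X : Type*) [Group G] [MulAction G X] [TopologicalSpace X]
    [DiscreteTopology X] [Nonempty X] [IsFSO G X] :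
    List.TFAE [
      IsAmenableAction G X,
      ∃ x : X, IsAmenableAction G (orbit G x),
      ∀ x : X, IsAmenableAction G (orbit G x),
      IsAmenableGroup (SchlichtingGroup G X)] := by
  tfae_have 3 → 2 := fun h => ⟨Classical.arbitrary X, h _⟩
  tfae_have 2 → 1 := fun ⟨x, h⟩ => h.map id ⟨Subtype.val, continuous_subtype_val⟩ fun _ _ => rfl
  tfae_have 1 → 4 := fun h => h.of_denseRange (SchlichtingGroup.of G X)
    (SchlichtingGroup.denseRange_of G X) SchlichtingGroup.of_inv_smul
    fun x y => SchlichtingGroup.isCompact_setOf_apply_eq y x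
  -- The orbit map `φ ↦ φ • x` stays in the `G`-orbit, since `φ` agrees at `x` with some element of
  -- `G`.
  tfae_have 4 → 3 := fun h x => IsAmenableAction.map h (SchlichtingGroup.of G X)
    ⟨fun φ => ⟨φ • x, φ.smul_mem_orbit x⟩, by fun_prop⟩ fun g φ => Subtype.ext <| by
      simpa [mul_smul] using SchlichtingGroup.of_inv_smul g (φ • x)
  tfae_finish
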